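/- Let $p,q,n$ be positive integers, $a=\pm1$ and $b=(-1)^{p+q-1}$, with $p\neq1$ when $b=1$ and $q\neq1$ when $a=1$. For $m\ge 0$ let $$\mathcal O_m^{(p)}(b)=\sum_{i=1}^{m}\frac{b^{i-1}}{(2i-1)^p}$$ be the odd (skew-)harmonic numbers. For $c=\pm1$ and $\alpha>0$ let $$\Phi(c,s,\alpha)=\sum_{m=0}^\infty\frac{c^m}{(m+\alpha)^s}$$ be the Lerch transcendent for integers $s\ge1$ (with $s\ne1$ if $c=1$), and let $\Phi(1,0,1)=\zeta(0)=-\tfrac12$ and $\Phi(-1,0,1)=\eta(0)=\tfrac12$ (analytic continuation). For $0<s<r$ and integers $k\ge1$ let $$\Theta(c,k,s,r)=\Phi\left(c,k,\tfrac{s}{r}\right)+c(-1)^k\,\Phi\left(c,k,\tfrac{r-s}{r}\right)\quad\text{if }(c,k)\ne(1,1),\qquad \Theta(1,1,s,r)=\pi\cot\left(\tfrac{\pi s}{r}\right).$$ Then the series $\sum_{k\ge1}a^k\mathcal O_{nk}^{(p)}(b)/k^q$ converges, and $$\begin{aligned}\sum_{k=1}^\infty\frac{a^k\,\mathcal O_{nk}^{(p)}(b)}{k^q}={}&\frac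 a2\left(1+(-1)^q\right)2^{-p}\,\Phi(a,q,1)\,\Phi\left(b,p,\tfrac12\right)\\ &+ab^{n-1}n^q(-2)^{-p}\sum_{k=0}^{\lfloor q/2\rfloor}\binom{p+q-2k-1}{p-1}n^{-2k}\,\Phi(ab^n,2k,1)\,\Phi\left(b,p+q-2k,\tfrac12\right)\\ &+\frac{ab}2(-2n)^{-p}\sum_{j=1}^{n}\sum_{k=1}^{p}\binom{p+q-k-1}{q-1}b^j(-1)^k\,\Theta(ab^n,k,2j-1,2n)\,\Phi\left(a,p+q-k,\tfrac{2n-2j+1}{2n}\right).\end{aligned}$$ -/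

import Mathlib

open Filter Topology

/-- The Lerch transcendent `Φ(c, q, α)` for a natural order `q` (used for `c = ±1`, `α > 0`).
For `q ≥ 1` it is the sum `∑_{m ≥ 0} c ^ m / (m + α) ^ q`, taken as the limit of the partial sums,
since the series is only conditionally convergent for `c = -1`, `q = 1`.
For `q = 0` the series diverges and the value is that of the analytic continuation in the order:
`ζ(0, α) = 1 / 2 - α` for `c = 1` (so `Φ(1, 0, 1) = ζ(0) = -1 / 2`), and `1 / (1 - c)` for `c ≠ 1`
(so `Φ(-1, 0, 1) = η(0) = 1 / 2`). -/
noncomputable def lerchPhi (c : ℝ) (q : ℕ) (α : ℝ) : ℝ :=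
  if q = 0 then
    if c = 1 then 1 / 2 - α else 1 / (1 - c)
  else
    limUnder atTop fun N : ℕ => ∑ m ∈ Finset.range N, c ^ m / ((m : ℝ) + α) ^ q

/-- `Φ(1, 0, 1) = ζ(0)`. -/
theorem lerchPhi_one_zero_one : ((lerchPhi 1 0 1 : ℝ) : ℂ) = riemannZeta 0 := by
  rw [riemannZeta_zero]
  norm_num [lerchPhi]

/-- `Φ(-1, 0, 1) = η(0)`, where `η(s) = (1 - 2 ^ (1 - s)) ζ(s)` is the Dirichlet eta function. -/
theorem lerchPhi_neg_one_zero_one :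
    ((lerchPhi (-1) 0 1 : ℝ) : ℂ) = (1 - 2 ^ (1 - (0 : ℂ))) * riemannZeta 0 := by
  rw [riemannZeta_zero]
  norm_num [lerchPhi]

/-- `Θ(c, q, s, r) = Φ(c, q, s / r) + c (-1) ^ q Φ(c, q, (r - s) / r)`. For `c = 1`, `q = 1` the two
series diverge separately, and `Θ(1, 1, s, r)` is the principal value of
`∫_0^∞ r x ^ (s - 1) / (1 - x ^ r) dx`, that is, `π cot (π s / r)`. -/
noncomputable def lerchTheta (c : ℝ) (q : ℕ) (s r : ℝ) : ℝ :=
  if c = 1 ∧ q = 1 then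
    Real.pi * Real.cot (Real.pi * s / r)
  else
    lerchPhi c q (s / r) + c * (-1) ^ q * lerchPhi c q ((r - s) / r)

/-- The odd (skew-)harmonic number `O_m^{(p)}(b) = ∑_{i = 1}^m b ^ (i - 1) / (2 i - 1) ^ p`. -/
noncomputable def oddHarmonic (p : ℕ) (b : ℝ) (m : ℕ) : ℝ :=
  ∑ i ∈ Finset.Icc 1 m, b ^ (i - 1) / (2 * (i : ℝ) - 1) ^ p

theorem sum_Icc_one_eq_sum_range (f : ℕ → ℝ) (N : ℕ) :
    ∑ k ∈ Finset.Icc 1 N, f k = ∑ k ∈ Finset.range N, f (k + 1) := by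
  induction N with
  | zero => simp
  | succ N ih => rw [Finset.sum_Icc_succ_top (by omega), ih, Finset.sum_range_succ]

theorem tendsto_add_const_pow_inv (α : ℝ) {k : ℕ} (hk : k ≠ 0) :
    Tendsto (fun m : ℕ => 1 / ((m : ℝ) + α) ^ k) atTop (𝓝 0) := by
  have h1 : Tendsto (fun m : ℕ => (m : ℝ) + α) atTop atTop :=
    tendsto_atTop_add_const_right _ _ tendsto_natCast_atTop_atTop
  simp only [one_div]
  exact ((tendsto_pow_atTop hk).comp h1).inv_tendsto_atTop

theorem tendsto_lerchPhi {c : ℝ} (hc : c = 1 ∨ c = -1) {k : ℕ} (hk : k ≠ 0)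
    (hck : ¬(c = 1 ∧ k = 1)) {α : ℝ} (hα : 0 < α) :
    Tendsto (fun N : ℕ => ∑ m ∈ Finset.range N, c ^ m / ((m : ℝ) + α) ^ k) atTop
      (𝓝 (lerchPhi c k α)) := by
  have key : ∃ l, Tendsto (fun N : ℕ => ∑ m ∈ Finset.range N, c ^ m / ((m : ℝ) + α) ^ k) atTop
      (𝓝 l) := by
    by_cases h1 : k = 1
    · have hc' : c = -1 := by
        rcases hc with h | h
        · exact absurd ⟨h, h1⟩ hck
        · exact h
      subst hc'
      have ha : Antitone fun m : ℕ => 1 / ((m : ℝ) + α) ^ k := by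
        intro x y hxy
        have : (x : ℝ) ≤ y := by exact_mod_cast hxy
        dsimp only
        gcongr
      obtain ⟨l, hl⟩ := ha.tendsto_alternating_series_of_tendsto_zero
        (tendsto_add_const_pow_inv α hk)
      exact ⟨l, by simpa [div_eq_mul_inv] using hl⟩
    · have hs : Summable fun m : ℕ => c ^ m / ((m : ℝ) + α) ^ k := by
        have h2 := (Real.summable_one_div_nat_add_rpow α (k : ℝ)).2
          (by exact_mod_cast (show 1 < k by omega))
        refine Summable.of_norm_bounded h2 fun m => ?_
        have hm : 0 < (m : ℝ) + α := by positivity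
        have habs : |c| = 1 := by rcases hc with h | h <;> simp [h]
        rw [abs_of_pos hm, Real.rpow_natCast, Real.norm_eq_abs, abs_div, abs_pow, habs, one_pow,
          abs_of_pos (pow_pos hm k)]
      exact ⟨_, hs.hasSum.tendsto_sum_nat⟩
  obtain ⟨l, hl⟩ := key
  have : lerchPhi c k α = l := by
    rw [lerchPhi, if_neg hk]
    exact hl.limUnder_eq
  rwa [this]

/-- The part with poles at `x = 0` of the partial fraction decomposition of
`1 / (x ^ (q + 1) * (s - x) ^ (p + 1))`. -/
noncomputable def polarPart (p q : ℕ) (s x : ℝ) : ℝ :=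
  ∑ j ∈ Finset.range (q + 1), ((p + q - j).choose p : ℝ) / s ^ (p + q + 1 - j) / x ^ (j + 1)

theorem polarPart_succ_succ (p q : ℕ) (s x : ℝ) :
    polarPart (p + 1) (q + 1) s x = (polarPart p (q + 1) s x + polarPart (p + 1) q s x) / s := by
  unfold polarPart
  rw [Finset.sum_range_succ, Finset.sum_range_succ (n := q + 1)]
  have key : ∀ A a B A' a' : ℝ, A' = (A + B) / s → a' = a / s → A' + a' = (A + a + B) / s := by
    rintro A a B _ _ rfl rfl
    ring
  apply key
  · rw [← Finset.sum_add_distrib, Finset.sum_div]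
    refine Finset.sum_congr rfl fun j hj => ?_
    have hj : j ≤ q := by simpa [Nat.lt_succ_iff] using hj
    obtain ⟨d, rfl⟩ := Nat.exists_eq_add_of_le hj
    rw [show p + 1 + (j + d + 1) - j = (p + d + 1) + 1 by omega,
      show p + 1 + (j + d + 1) + 1 - j = (p + d + 2) + 1 by omega,
      show p + (j + d + 1) - j = p + d + 1 by omega,
      show p + (j + d + 1) + 1 - j = p + d + 2 by omega,
      show p + 1 + (j + d) - j = p + d + 1 by omega,
      show p + 1 + (j + d) + 1 - j = p + d + 2 by omega, Nat.choose_succ_succ, pow_succ s]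
    push_cast
    rw [div_mul_eq_div_div]
    ring
  · rw [show p + 1 + (q + 1) - (q + 1) = p + 1 by omega,
      show p + 1 + (q + 1) + 1 - (q + 1) = p + 1 + 1 by omega,
      show p + (q + 1) - (q + 1) = p by omega,
      show p + (q + 1) + 1 - (q + 1) = p + 1 by omega, Nat.choose_self, Nat.choose_self,
      pow_succ s (p + 1), div_mul_eq_div_div]
    ring

theorem polarPart_zero_succ (q : ℕ) (s x : ℝ) :
    polarPart 0 (q + 1) s x = (polarPart 0 q s x + 1 / x ^ (q + 2)) / s := by
  unfold polarPart
  rw [Finset.sum_range_succ, add_div, Finset.sum_div]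
  congr 1
  · refine Finset.sum_congr rfl fun j hj => ?_
    have hj : j ≤ q := by simpa [Nat.lt_succ_iff] using hj
    rw [show 0 + (q + 1) + 1 - j = (0 + q + 1 - j) + 1 by omega, pow_succ s, div_mul_eq_div_div]
    simp only [Nat.choose_zero_right]
    ring
  · rw [show 0 + (q + 1) + 1 - (q + 1) = 1 by omega]
    simp only [Nat.choose_zero_right, Nat.cast_one, pow_one]
    ring

theorem polarPart_succ_zero (p : ℕ) (s x : ℝ) :
    polarPart (p + 1) 0 s x = polarPart p 0 s x / s := by
  simp only [polarPart, zero_add, Finset.sum_range_one, add_zero, Nat.sub_zero, Nat.choose_self,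
    pow_succ s (p + 1), div_mul_eq_div_div]
  ring

/-- Partial fraction decomposition of `1 / (x ^ (q + 1) * y ^ (p + 1))` when `x + y = s`. -/
theorem one_div_pow_mul_pow (p q : ℕ) {x y s : ℝ} (hx : x ≠ 0) (hy : y ≠ 0) (hs : s ≠ 0)
    (hxy : x + y = s) :
    1 / (x ^ (q + 1) * y ^ (p + 1)) = polarPart p q s x + polarPart q p s y := by
  have base (q : ℕ) : ∀ x y : ℝ, x ≠ 0 → y ≠ 0 → x + y = s →
      1 / (x ^ (q + 1) * y) = polarPart 0 q s x + polarPart q 0 s y := by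
    intro x y hx hy hxy
    induction q with
    | zero =>
      simp only [polarPart, zero_add, Finset.sum_range_one, add_zero, Nat.sub_zero,
        Nat.choose_self, Nat.cast_one, pow_one]
      field_simp
      linarith
    | succ q ih =>
      rw [polarPart_zero_succ, polarPart_succ_zero, ← add_div, add_right_comm (polarPart 0 q s x), ← ih,
        eq_div_iff hs, ← hxy]
      field_simp
      ring
  induction p generalizing q with
  | zero => simpa using base q x y hx hy hxy
  | succ p ihp =>
    induction q with
    | zero =>
      have := base (p + 1) y x hy hx (by rw [add_comm, hxy])
      rw [add_comm (polarPart _ _ _ _), ← this]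
      ring
    | succ q ihq =>
      rw [polarPart_succ_succ, polarPart_succ_succ, ← add_div,
        show polarPart p (q + 1) s x + polarPart (p + 1) q s x +
          (polarPart q (p + 1) s y + polarPart (q + 1) p s y) =
          (polarPart p (q + 1) s x + polarPart (q + 1) p s y) +
          (polarPart (p + 1) q s x + polarPart q (p + 1) s y) by ring, ← ihp (q + 1), ← ihq,
        eq_div_iff hs, ← hxy]
      field_simp
      ring

/-- `θ` is the value of the bilateral series `∑_{k ∈ ℤ} c ^ k / (α + k) ^ j`. -/
def HasBilateralSum (c : ℝ) (j : ℕ) (α θ : ℝ) : Prop :=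
  Tendsto (fun K : ℕ => ∑ k ∈ Finset.range K,
    (c ^ k / (α + k) ^ j + c ^ (k + 1) / (α - (k + 1)) ^ j)) atTop (𝓝 θ)

theorem tendsto_sign_pow_mul {c : ℝ} (hc : c = 1 ∨ c = -1) {f : ℕ → ℝ}
    (hf : Tendsto f atTop (𝓝 0)) : Tendsto (fun k => c ^ k * f k) atTop (𝓝 0) := by
  refine squeeze_zero_norm (fun k => ?_) (tendsto_zero_iff_norm_tendsto_zero.1 hf)
  rcases hc with h | h <;> simp [h]

theorem tendsto_sign_pow_div_add {c : ℝ} (hc : c = 1 ∨ c = -1) {j : ℕ} (hj : j ≠ 0) (α : ℝ) :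
    Tendsto (fun k : ℕ => c ^ k / (α + k) ^ j) atTop (𝓝 0) := by
  have := tendsto_sign_pow_mul hc (tendsto_add_const_pow_inv α hj)
  simpa [div_eq_mul_inv, add_comm] using this

theorem tendsto_sign_pow_div_sub {c : ℝ} (hc : c = 1 ∨ c = -1) {j : ℕ} (hj : j ≠ 0) (α : ℝ) :
    Tendsto (fun k : ℕ => c ^ k / (α - k) ^ j) atTop (𝓝 0) := by
  have h := (tendsto_sign_pow_div_add hc hj (-α)).const_mul ((-1) ^ j)
  rw [mul_zero] at h
  refine h.congr fun k => ?_
  rw [show α - (k : ℝ) = (-1) * (-α + k) by ring, mul_pow, div_mul_eq_div_div]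
  rcases neg_one_pow_eq_or ℝ j with h | h <;> rw [h] <;> ring

theorem HasBilateralSum.add_one {c : ℝ} (hc : c = 1 ∨ c = -1) {j : ℕ} (hj : j ≠ 0) {α θ : ℝ}
    (h : HasBilateralSum c j α θ) : HasBilateralSum c j (α + 1) (c * θ) := by
  have hc2 : c * c = 1 := by rcases hc with h | h <;> simp [h]
  have h1 : Tendsto (fun K : ℕ => c * ∑ k ∈ Finset.range K,
      (c ^ k / (α + k) ^ j + c ^ (k + 1) / (α - (k + 1)) ^ j) +
      c * (c ^ K / (α + K) ^ j - c ^ K / (α - K) ^ j)) atTop (𝓝 (c * θ + c * (0 - 0))) :=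
    (Tendsto.const_mul c h).add (((tendsto_sign_pow_div_add hc hj α).sub
      (tendsto_sign_pow_div_sub hc hj α)).const_mul c)
  rw [sub_zero, mul_zero, add_zero] at h1
  refine h1.congr fun K => ?_
  induction K with
  | zero => simp
  | succ K ih =>
    rw [Finset.sum_range_succ, Finset.sum_range_succ, ← ih]
    push_cast
    rw [show α + 1 + (K : ℝ) = α + (K + 1) by ring, show α + 1 - ((K : ℝ) + 1) = α - K by ring]
    rw [pow_succ c K]
    linear_combination (c ^ K / (α + (K + 1)) ^ j) * hc2

theorem HasBilateralSum.add_nat {c : ℝ} (hc : c = 1 ∨ c = -1) {j : ℕ} (hj : j ≠ 0) {α θ : ℝ}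
    (h : HasBilateralSum c j α θ) (u : ℕ) : HasBilateralSum c j (α + u) (c ^ u * θ) := by
  induction u with
  | zero => simpa using h
  | succ u ih =>
    have := ih.add_one hc hj
    rw [← mul_assoc, ← pow_succ'] at this
    simpa [add_assoc] using this

theorem hasBilateralSum_cot {α : ℝ} (h0 : 0 < α) (h1 : α < 1) :
    HasBilateralSum 1 1 α (Real.pi * Real.cot (Real.pi * α)) := by
  have hmem : (α : ℂ) ∈ Complex.integerComplement := by
    rintro ⟨m, hm⟩
    have hm' : (m : ℝ) = α := by exact_mod_cast hm
    rw [← hm'] at h0 h1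
    have h0' : 0 < m := by exact_mod_cast h0
    have h1' : m < 1 := by exact_mod_cast h1
    omega
  have h := tendsto_logDeriv_euler_cot_sub hmem
  have h2 : Tendsto (fun N : ℕ => ∑ k ∈ Finset.range N, (1 / (α - (k + 1)) + 1 / (α + (k + 1))))
      atTop (𝓝 (Real.pi * Real.cot (Real.pi * α) - 1 / α)) := by
    have h3 := (Complex.continuous_re.tendsto _).comp h
    refine (h3.congr fun N => ?_).trans (le_of_eq ?_)
    · simp only [Function.comp, cotTerm]
      rw [← Complex.ofReal_re (∑ k ∈ Finset.range N, _)]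
      push_cast
      rfl
    · rw [← Complex.ofReal_re (Real.pi * Real.cot (Real.pi * α) - 1 / α)]
      push_cast
      rfl
  have h4 := h2.add ((tendsto_const_nhds (x := 1 / α)).sub
    (tendsto_sign_pow_div_add (c := 1) (Or.inl rfl) one_ne_zero α))
  rw [sub_zero, sub_add_cancel] at h4
  refine h4.congr fun N => ?_
  induction N with
  | zero => simp
  | succ N ih =>
    rw [Finset.sum_range_succ, Finset.sum_range_succ, ← ih]
    push_cast
    simp only [one_pow, pow_one]
    ring

theorem hasBilateralSum_lerchTheta {c : ℝ} (hc : c = 1 ∨ c = -1) {j : ℕ} (hj : j ≠ 0) {s r : ℝ}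
    (hs : 0 < s) (hsr : s < r) : HasBilateralSum c j (s / r) (lerchTheta c j s r) := by
  have hr : 0 < r := hs.trans hsr
  unfold lerchTheta
  split_ifs with h
  · obtain ⟨rfl, rfl⟩ := h
    rw [mul_div_assoc]
    exact hasBilateralSum_cot (by positivity) ((div_lt_one hr).2 hsr)
  · have h1 := tendsto_lerchPhi hc hj h (div_pos hs hr)
    have h2 := (tendsto_lerchPhi hc hj h (div_pos (sub_pos.2 hsr) hr)).const_mul (c * (-1) ^ j)
    refine (h1.add h2).congr fun K => ?_
    rw [Finset.mul_sum, ← Finset.sum_add_distrib]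
    refine Finset.sum_congr rfl fun k _ => ?_
    rw [show s / r - ((k : ℝ) + 1) = (-1) * (k + (r - s) / r) by field_simp; ring, mul_pow,
      add_comm (s / r), pow_succ' c, div_mul_eq_div_div]
    rcases neg_one_pow_eq_or ℝ j with h | h <;> rw [h] <;> ring

theorem lerchTheta_sub {c : ℝ} (hc : c = 1 ∨ c = -1) (j : ℕ) {s r : ℝ} (hr : r ≠ 0) :
    lerchTheta c j (r - s) r = c * (-1) ^ j * lerchTheta c j s r := by
  unfold lerchTheta
  split_ifs with h
  · obtain ⟨rfl, rfl⟩ := h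
    rw [show Real.pi * (r - s) / r = Real.pi - Real.pi * s / r by field_simp,
      Real.cot_eq_cos_div_sin, Real.cot_eq_cos_div_sin, Real.cos_pi_sub, Real.sin_pi_sub]
    ring
  · rw [sub_sub_cancel]
    rcases hc with h | h <;> rcases neg_one_pow_eq_or ℝ j with h' | h' <;> rw [h, h'] <;> ring

/-- The terms with indices `k + 1` and `-(k + 1)` of `∑_{l ≠ 0} c ^ l / (l ^ q * (α - l) ^ p)`,
for `c = ±1`, taken together. -/
noncomputable def pairTerm (c : ℝ) (p q : ℕ) (α : ℝ) (k : ℕ) : ℝ :=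
  c ^ (k + 1) / (((k : ℝ) + 1) ^ q * (α - (k + 1)) ^ p) +
    c ^ (k + 1) / ((-((k : ℝ) + 1)) ^ q * (α + (k + 1)) ^ p)

theorem tendsto_sum_pairTerm_left {c : ℝ} (hc : c = 1 ∨ c = -1) {j : ℕ} (hj : j ≠ 0)
    (hcj : Even j → ¬(c = 1 ∧ j = 1)) :
    Tendsto (fun K : ℕ => ∑ k ∈ Finset.range K,
      (c ^ (k + 1) / ((k : ℝ) + 1) ^ j + c ^ (k + 1) / (-((k : ℝ) + 1)) ^ j)) atTop
      (𝓝 ((1 + (-1) ^ j) * (c * lerchPhi c j 1))) := by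
  rcases Nat.even_or_odd j with he | ho
  · have h := (tendsto_lerchPhi hc hj (hcj he) one_pos).const_mul (2 * c)
    rw [he.neg_one_pow]
    refine (h.congr fun K => ?_).trans (le_of_eq (by ring_nf))
    rw [Finset.mul_sum]
    refine Finset.sum_congr rfl fun k _ => ?_
    rw [he.neg_pow]
    ring
  · rw [ho.neg_one_pow]
    simp only [ho.neg_pow, div_neg, add_neg_cancel, Finset.sum_const_zero, zero_mul]
    exact tendsto_const_nhds

theorem tendsto_sum_pairTerm_right {c : ℝ} (hc : c = 1 ∨ c = -1) {j : ℕ} (hj : j ≠ 0) {α θ : ℝ}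
    (h : HasBilateralSum c j α θ) :
    Tendsto (fun K : ℕ => ∑ k ∈ Finset.range K,
      (c ^ (k + 1) / (α - (k + 1)) ^ j + c ^ (k + 1) / (α + (k + 1)) ^ j)) atTop
      (𝓝 (θ - 1 / α ^ j)) := by
  have h1 := (Tendsto.add h (tendsto_sign_pow_div_add hc hj α)).sub
    (tendsto_const_nhds (x := 1 / α ^ j))
  rw [add_zero] at h1
  refine h1.congr fun K => ?_
  induction K with
  | zero => simp
  | succ K ih =>
    rw [Finset.sum_range_succ, Finset.sum_range_succ, ← ih]
    push_cast
    ring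

theorem tendsto_sum_pairTerm {c : ℝ} (hc : c = 1 ∨ c = -1) (p q : ℕ) {α : ℝ} (θ : ℕ → ℝ)
    (h0 : α ≠ 0) (hsub : ∀ k : ℕ, α - (k + 1) ≠ 0) (hadd : ∀ k : ℕ, α + (k + 1) ≠ 0)
    (hθ : ∀ j, HasBilateralSum c (j + 1) α (θ j)) :
    Tendsto (fun K : ℕ => ∑ k ∈ Finset.range K, pairTerm c (p + 1) (q + 1) α k) atTop
      (𝓝 (∑ j ∈ Finset.range (q + 1), ((p + q - j).choose p : ℝ) / α ^ (p + q + 1 - j) *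
            ((1 + (-1) ^ (j + 1)) * (c * lerchPhi c (j + 1) 1)) +
          ∑ j ∈ Finset.range (p + 1), ((q + p - j).choose q : ℝ) / α ^ (q + p + 1 - j) *
            (θ j - 1 / α ^ (j + 1)))) := by
  have hodd (j : ℕ) : Even (j + 1) → ¬(c = 1 ∧ j + 1 = 1) := by
    rintro he ⟨-, h⟩
    rw [h] at he
    exact absurd he (by decide)
  have h1 := (tendsto_finsetSum (Finset.range (q + 1)) fun j _ =>
      (tendsto_sum_pairTerm_left hc (j := j + 1) j.succ_ne_zero (hodd j)).const_mul
        (((p + q - j).choose p : ℝ) / α ^ (p + q + 1 - j))).add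
    (tendsto_finsetSum (Finset.range (p + 1)) fun j _ =>
      (tendsto_sum_pairTerm_right hc (j := j + 1) j.succ_ne_zero (hθ j)).const_mul
        (((q + p - j).choose q : ℝ) / α ^ (q + p + 1 - j)))
  refine h1.congr fun K => ?_
  simp only [Finset.mul_sum]
  rw [Finset.sum_comm, Finset.sum_comm (s := Finset.range (p + 1)), ← Finset.sum_add_distrib]
  refine Finset.sum_congr rfl fun k _ => ?_
  have hk : (k : ℝ) + 1 ≠ 0 := by positivity
  unfold pairTerm
  rw [div_eq_mul_one_div, one_div_pow_mul_pow p q hk (hsub k) h0 (by ring),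
    div_eq_mul_one_div (c ^ (k + 1)) ((-((k : ℝ) + 1)) ^ (q + 1) * _),
    one_div_pow_mul_pow p q (neg_ne_zero.2 hk) (hadd k) h0 (by ring)]
  unfold polarPart
  simp only [mul_add, Finset.mul_sum, Finset.sum_add_distrib]
  have e : ∀ A B C D A' B' C' D' : ℝ, A = A' → B = B' → C = C' → D = D' →
      A + B + (C + D) = A' + C' + (B' + D') := by intros; subst_vars; ring
  apply e <;> exact Finset.sum_congr rfl fun j _ => by ring

theorem oddHarmonic_zero (p : ℕ) (b : ℝ) : oddHarmonic p b 0 = 0 := by simp [oddHarmonic]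

theorem oddHarmonic_succ (p : ℕ) (b : ℝ) (m : ℕ) :
    oddHarmonic p b (m + 1) = oddHarmonic p b m + b ^ m / (2 * (m : ℝ) + 1) ^ p := by
  rw [oddHarmonic, Finset.sum_Icc_succ_top (by omega), oddHarmonic]
  push_cast
  rw [show 2 * ((m : ℝ) + 1) - 1 = 2 * m + 1 by ring]

theorem tendsto_oddHarmonic {b : ℝ} (hb : b = 1 ∨ b = -1) {p : ℕ} (hp : p ≠ 0)
    (hbp : ¬(b = 1 ∧ p = 1)) :
    Tendsto (oddHarmonic p b) atTop (𝓝 ((2 ^ p)⁻¹ * lerchPhi b p (1 / 2))) := by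
  refine ((tendsto_lerchPhi hb hp hbp one_half_pos).const_mul _).congr fun N => ?_
  induction N with
  | zero => simp [oddHarmonic_zero]
  | succ N ih =>
    rw [Finset.sum_range_succ, mul_add, ih, oddHarmonic_succ,
      show 2 * (N : ℝ) + 1 = 2 * (N + 1 / 2) by ring, mul_pow, div_mul_eq_div_div]
    ring

/-- The extension of the odd harmonic numbers to integer indices by `O_{-m} = ε O_m`. -/
noncomputable def oddHarmonicInt (p : ℕ) (b ε : ℝ) : ℤ → ℝ
  | Int.ofNat m => oddHarmonic p b m
  | Int.negSucc m => ε * oddHarmonic p b (m + 1)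

theorem oddHarmonicInt_natCast (p : ℕ) (b ε : ℝ) (m : ℕ) :
    oddHarmonicInt p b ε m = oddHarmonic p b m := rfl

theorem oddHarmonicInt_neg_natCast (p : ℕ) (b ε : ℝ) (m : ℕ) :
    oddHarmonicInt p b ε (-m) = ε * oddHarmonic p b m := by
  cases m with
  | zero =>
    rw [Nat.cast_zero, neg_zero, oddHarmonic_zero, mul_zero, ← Nat.cast_zero,
      oddHarmonicInt_natCast, oddHarmonic_zero]
  | succ m => rfl

theorem sign_zpow_neg {b : ℝ} (hb : b = 1 ∨ b = -1) (m : ℤ) : b ^ (-m) = b ^ m := by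
  rcases hb with rfl | rfl
  · simp
  · rw [zpow_neg, ← inv_zpow]
    norm_num

theorem oddHarmonicInt_add_one {p : ℕ} {b ε : ℝ} (hb : b = 1 ∨ b = -1)
    (hε : b * (-1) ^ p = -ε) (m : ℤ) :
    oddHarmonicInt p b ε (m + 1) = oddHarmonicInt p b ε m + b ^ m / (2 * (m : ℝ) + 1) ^ p := by
  rcases Int.eq_nat_or_neg m with ⟨k, rfl | rfl⟩
  · rw [show (k : ℤ) + 1 = ((k + 1 : ℕ) : ℤ) by push_cast; rfl, oddHarmonicInt_natCast,
      oddHarmonicInt_natCast, oddHarmonic_succ]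
    simp
  · cases k with
    | zero =>
      have := oddHarmonic_succ p b 0
      have h0 := oddHarmonicInt_natCast p b ε 0
      have h1 := oddHarmonicInt_natCast p b ε 1
      norm_num at this h0 h1 ⊢
      rw [h0, h1, this]
    | succ k =>
      rw [show -((k + 1 : ℕ) : ℤ) + 1 = -(k : ℤ) by push_cast; ring, oddHarmonicInt_neg_natCast,
        oddHarmonicInt_neg_natCast, oddHarmonic_succ, sign_zpow_neg hb, zpow_natCast]
      push_cast
      rw [show 2 * (-((k : ℝ) + 1)) + 1 = (-1) * (2 * k + 1) by ring, mul_pow, pow_succ,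
        div_mul_eq_div_div]
      have h1 : ((-1 : ℝ) ^ p)⁻¹ = (-1) ^ p := by
        rcases neg_one_pow_eq_or ℝ p with h | h <;> rw [h] <;> norm_num
      rw [div_eq_mul_inv _ ((-1 : ℝ) ^ p), h1, mul_assoc (b ^ k), hε]
      ring

theorem sum_range_eq_oddHarmonicInt_sub {p : ℕ} {b ε : ℝ} (hb : b = 1 ∨ b = -1)
    (hε : b * (-1) ^ p = -ε) (m : ℤ) (N : ℕ) :
    ∑ i ∈ Finset.range N, b ^ (m + i) / (2 * ((m : ℝ) + i) + 1) ^ p =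
      oddHarmonicInt p b ε (m + N) - oddHarmonicInt p b ε m := by
  induction N with
  | zero => simp
  | succ N ih =>
    rw [Finset.sum_range_succ, ih]
    have := oddHarmonicInt_add_one hb hε (m + N)
    push_cast at this ⊢
    rw [← add_assoc, this]
    ring

theorem sum_range_window {p : ℕ} {b ε : ℝ} (hb : b = 1 ∨ b = -1)
    (hε : b * (-1) ^ p = -ε) (m : ℤ) (N : ℕ) :
    ∑ i ∈ Finset.range N, b ^ i / (2 * (i : ℝ) + 1 - 2 * m) ^ p =
      b ^ m * (oddHarmonicInt p b ε (N - m) - oddHarmonicInt p b ε (-m)) := by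
  have hb0 : b ≠ 0 := by rcases hb with h | h <;> rw [h] <;> norm_num
  rw [show (N : ℤ) - m = -m + N by ring, ← sum_range_eq_oddHarmonicInt_sub hb hε, Finset.mul_sum]
  refine Finset.sum_congr rfl fun i _ => ?_
  rw [← mul_div_assoc, ← zpow_add₀ hb0, add_neg_cancel_left, zpow_natCast]
  push_cast
  ring_nf

theorem abs_oddHarmonicInt_sub_le {p n : ℕ} (hp : p ≠ 0) {b ε : ℝ} (hb : b = 1 ∨ b = -1)
    (hε : b * (-1) ^ p = -ε) (m : ℤ) :
    |oddHarmonicInt p b ε (n * m) - oddHarmonicInt p b ε (n * (m - 1))| ≤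
      (2 * n) / (1 + |(m : ℝ)|) := by
  rw [show (n : ℤ) * m = n * (m - 1) + n by ring, ← sum_range_eq_oddHarmonicInt_sub hb hε]
  refine (Finset.abs_sum_le_sum_abs _ _).trans ?_
  have key : ∀ i ∈ Finset.range n, |b ^ ((n : ℤ) * (m - 1) + i) /
      (2 * (((n * (m - 1) : ℤ) : ℝ) + i) + 1) ^ p| ≤ 2 / (1 + |(m : ℝ)|) := by
    intro i hi
    have hi : (i : ℤ) + 1 ≤ n := by exact_mod_cast Finset.mem_range.1 hi
    have hb1 : |b| = 1 := by rcases hb with h | h <;> simp [h]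
    have hx : 1 + |m| ≤ 2 * |2 * (n * (m - 1) + i) + 1| := by
      rcases le_or_gt 1 m with hm | hm
      · rw [abs_of_nonneg (by omega : 0 ≤ m)]
        have : 0 ≤ ((n : ℤ) - 1) * (m - 1) := mul_nonneg (by omega) (by omega)
        rw [abs_of_nonneg] <;> nlinarith
      · rw [abs_of_nonpos (by omega : m ≤ 0)]
        have : 0 ≤ ((n : ℤ) - 1) * (-m) := mul_nonneg (by omega) (by omega)
        rw [abs_of_nonpos] <;> nlinarith
    have hx1 : 1 ≤ |2 * ((n : ℤ) * (m - 1) + i) + 1| := by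
      have := abs_nonneg m
      omega
    set x : ℤ := 2 * (n * (m - 1) + i) + 1 with hxdef
    have hcast : 2 * (((n * (m - 1) : ℤ) : ℝ) + i) + 1 = (x : ℝ) := by
      rw [hxdef]
      push_cast
      ring
    have hx' : 1 + |(m : ℝ)| ≤ 2 * |(x : ℝ)| := by exact_mod_cast hx
    have hx1' : 1 ≤ |(x : ℝ)| := by exact_mod_cast hx1
    rw [hcast, abs_div, abs_zpow, hb1, one_zpow, abs_pow,
      div_le_div_iff₀ (by positivity) (by positivity), one_mul]
    exact hx'.trans (mul_le_mul_of_nonneg_left (le_self_pow₀ hx1' hp) zero_le_two)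
  refine (Finset.sum_le_sum key).trans (le_of_eq ?_)
  rw [Finset.sum_const, Finset.card_range, nsmul_eq_mul]
  ring

theorem sum_pairTerm {p q n : ℕ} (hn : n ≠ 0) {a b : ℝ} (hb : b = 1 ∨ b = -1)
    (hε : b * (-1) ^ p = -(-1) ^ q) (N k : ℕ) :
    ∑ i ∈ Finset.range N, b ^ i * pairTerm (a * b ^ n) p q ((2 * (i : ℝ) + 1) / (2 * n)) k =
      (2 * n) ^ p * (a ^ (k + 1) / ((k : ℝ) + 1) ^ q *
        (oddHarmonicInt p b ((-1) ^ q) (N - n * (k + 1)) +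
          (-1) ^ q * oddHarmonicInt p b ((-1) ^ q) (N + n * (k + 1))) -
        2 * (-1) ^ q * (a ^ (k + 1) * oddHarmonic p b (n * (k + 1)) / ((k : ℝ) + 1) ^ q)) := by
  have hn' : (n : ℝ) ≠ 0 := by exact_mod_cast hn
  have h1 := sum_range_window hb hε (n * (k + 1)) N
  have h2 := sum_range_window hb hε (-(n * (k + 1))) N
  have hterm (i : ℕ) : b ^ i * pairTerm (a * b ^ n) p q ((2 * (i : ℝ) + 1) / (2 * n)) k =
      (2 * n) ^ p * ((a * b ^ n) ^ (k + 1) / ((k : ℝ) + 1) ^ q) *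
        (b ^ i / (2 * (i : ℝ) + 1 - 2 * ((n * (k + 1) : ℤ) : ℝ)) ^ p) +
      (2 * n) ^ p * ((-1) ^ q * (a * b ^ n) ^ (k + 1) / ((k : ℝ) + 1) ^ q) *
        (b ^ i / (2 * (i : ℝ) + 1 - 2 * ((-(n * (k + 1)) : ℤ) : ℝ)) ^ p) := by
    unfold pairTerm
    push_cast
    rw [show (2 * (i : ℝ) + 1) / (2 * n) - (k + 1) =
      (2 * (i : ℝ) + 1 - 2 * (n * (k + 1))) / (2 * n) by field_simp,
      show (2 * (i : ℝ) + 1) / (2 * n) + (k + 1) =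
      (2 * (i : ℝ) + 1 - 2 * (-(n * (k + 1)))) / (2 * n) by field_simp; ring,
      neg_pow ((k : ℝ) + 1) q, div_pow _ (2 * (n : ℝ)), div_pow _ (2 * (n : ℝ))]
    have h3 : ((-1 : ℝ) ^ q)⁻¹ = (-1) ^ q := by
      rcases neg_one_pow_eq_or ℝ q with h | h <;> rw [h] <;> norm_num
    simp only [div_eq_mul_inv, mul_inv, inv_inv, h3]
    ring
  simp only [hterm]
  rw [Finset.sum_add_distrib, ← Finset.mul_sum, ← Finset.mul_sum, h1, h2, neg_neg,
    sign_zpow_neg hb, show ((n : ℤ) * (k + 1)) = ((n * (k + 1) : ℕ) : ℤ) by push_cast; ring,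
    oddHarmonicInt_natCast, oddHarmonicInt_neg_natCast, zpow_natCast, sub_neg_eq_add]
  have hbb : (a * b ^ n) ^ (k + 1) * b ^ (n * (k + 1)) = a ^ (k + 1) := by
    rw [mul_pow, ← pow_mul, mul_assoc, ← mul_pow]
    rcases hb with h | h <;> simp [h]
  have hbd : (a * b ^ n) ^ (k + 1) / ((k : ℝ) + 1) ^ q * b ^ (n * (k + 1)) =
      a ^ (k + 1) / ((k : ℝ) + 1) ^ q := by rw [← hbb]; ring
  simp only [mul_div_assoc]
  set Y := oddHarmonic p b (n * (k + 1))
  set Z1 := oddHarmonicInt p b ((-1) ^ q) _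
  set Z2 := oddHarmonicInt p b ((-1) ^ q) (N + _)
  linear_combination ((2 * (n : ℝ)) ^ p * (Z1 - (-1) ^ q * Y) +
    (2 * (n : ℝ)) ^ p * (-1) ^ q * (Z2 - Y)) * hbd

theorem summable_one_div_one_add_abs_mul_sqrt :
    Summable fun m : ℤ => 1 / ((1 + |(m : ℝ)|) * √(1 + |(m : ℝ)|)) := by
  have h := (Real.summable_one_div_int_add_rpow (1 / 2) (3 / 2)).2 (by norm_num)
  refine Summable.of_nonneg_of_le (fun m => by positivity) (fun m => ?_) h
  have h0 : (m : ℝ) + 1 / 2 ≠ 0 := by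
    intro h
    have h2 : (2 * m + 1 : ℤ) = 0 := by
      have : (2 * (m : ℝ) + 1) = 0 := by linarith
      exact_mod_cast this
    omega
  have h1 : (1 + |(m : ℝ)|) * √(1 + |(m : ℝ)|) = (1 + |(m : ℝ)|) ^ (3 / 2 : ℝ) := by
    rw [show (3 / 2 : ℝ) = 1 + 1 / 2 by norm_num, Real.rpow_add (by positivity), Real.rpow_one,
      Real.sqrt_eq_rpow]
  rw [h1]
  have h2 : |(m : ℝ) + 1 / 2| ≤ 1 + |(m : ℝ)| := by
    refine (abs_add_le _ _).trans ?_
    rw [abs_of_pos (by norm_num : (0 : ℝ) < 1 / 2)]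
    linarith
  have h3 := abs_pos.2 h0
  gcongr

theorem one_div_mul_le_of_le_add {u v s : ℝ} (hu : 0 < u) (hv : 0 < v) (hs : 0 < s)
    (h : s ≤ u + v) : 1 / (u * v) ≤ 1 / √(s / 2) * (1 / (u * √u) + 1 / (v * √v)) := by
  have key : ∀ u v : ℝ, 0 < u → 0 < v → s ≤ u + v → u ≤ v →
      1 / (u * v) ≤ 1 / √(s / 2) * (1 / (u * √u)) := by
    intro u v hu hv h huv
    rw [← one_div_mul_one_div_rev, one_div_mul_one_div, one_div_mul_one_div]
    have h1 : √(s / 2) ≤ √v := Real.sqrt_le_sqrt (by linarith)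
    have h2 : √u ≤ √v := Real.sqrt_le_sqrt huv
    have h3 : √v * √v = v := Real.mul_self_sqrt hv.le
    have h4 : 0 < √(s / 2) := Real.sqrt_pos.2 (by linarith)
    have h5 : 0 < √u := Real.sqrt_pos.2 hu
    apply one_div_le_one_div_of_le (by positivity)
    calc √(s / 2) * (u * √u) = u * (√(s / 2) * √u) := by ring
      _ ≤ u * (√v * √v) := by gcongr
      _ = v * u := by rw [h3]; ring
  have hu' : 0 ≤ 1 / √(s / 2) * (1 / (u * √u)) := by positivity
  have hv' : 0 ≤ 1 / √(s / 2) * (1 / (v * √v)) := by positivity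
  rw [mul_add]
  rcases le_total u v with huv | huv
  · linarith [key u v hu hv h huv]
  · have := key v u hv hu (by linarith) huv
    rw [mul_comm v u] at this
    linarith

theorem one_div_succ_mul_le (M k : ℕ) :
    1 / (((k : ℝ) + 2) * (1 + |(M : ℝ) - (k + 1)|)) ≤ 1 / √(((M : ℝ) + 2) / 2) *
      (1 / ((1 + |(((k : ℤ) + 1 : ℤ) : ℝ)|) * √(1 + |(((k : ℤ) + 1 : ℤ) : ℝ)|)) +
       1 / ((1 + |(((M : ℤ) - (k + 1) : ℤ) : ℝ)|) *
        √(1 + |(((M : ℤ) - (k + 1) : ℤ) : ℝ)|))) := by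
  push_cast
  rw [abs_of_nonneg (by positivity : 0 ≤ (k : ℝ) + 1), show 1 + ((k : ℝ) + 1) = k + 2 by ring]
  apply one_div_mul_le_of_le_add (by positivity) (by positivity) (by positivity)
  linarith [le_abs_self ((M : ℝ) - (k + 1))]

theorem summable_one_div_succ_mul (M : ℕ) :
    Summable fun k : ℕ => 1 / (((k : ℝ) + 2) * (1 + |(M : ℝ) - (k + 1)|)) := by
  have h := summable_one_div_one_add_abs_mul_sqrt
  refine Summable.of_nonneg_of_le (fun k => by positivity) (one_div_succ_mul_le M) ?_
  refine Summable.mul_left _ (Summable.add ?_ ?_)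
  · exact h.comp_injective (i := fun k : ℕ => (k : ℤ) + 1) fun x y hxy => by
      simpa using hxy
  · exact h.comp_injective (i := fun k : ℕ => (M : ℤ) - (k + 1)) fun x y hxy => by
      simpa using hxy

theorem tendsto_tsum_one_div_succ_mul :
    Tendsto (fun M : ℕ => ∑' k : ℕ, 1 / (((k : ℝ) + 2) * (1 + |(M : ℝ) - (k + 1)|))) atTop
      (𝓝 0) := by
  have h := summable_one_div_one_add_abs_mul_sqrt
  set φ : ℤ → ℝ := fun m => 1 / ((1 + |(m : ℝ)|) * √(1 + |(m : ℝ)|)) with hφ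
  have hpos : ∀ m, 0 ≤ φ m := fun m => by rw [hφ]; positivity
  have hlim : Tendsto (fun M : ℕ => 1 / √(((M : ℝ) + 2) / 2) * (2 * ∑' m, φ m)) atTop (𝓝 0) := by
    have h1 : Tendsto (fun M : ℕ => √(((M : ℝ) + 2) / 2)) atTop atTop :=
      Real.tendsto_sqrt_atTop.comp ((tendsto_atTop_add_const_right _ _
        tendsto_natCast_atTop_atTop).atTop_div_const two_pos)
    have h2 := h1.inv_tendsto_atTop.mul_const (2 * ∑' m, φ m)
    rw [zero_mul] at h2
    refine h2.congr fun M => by simp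
  refine squeeze_zero (fun M => tsum_nonneg fun k => by positivity) (fun M => ?_) hlim
  have i1 : Function.Injective fun k : ℕ => (k : ℤ) + 1 := fun x y hxy => by simpa using hxy
  have i2 : Function.Injective fun k : ℕ => (M : ℤ) - (k + 1) := fun x y hxy => by simpa using hxy
  have s1 := h.comp_injective i1
  have s2 := h.comp_injective i2
  refine ((summable_one_div_succ_mul M).tsum_le_tsum (one_div_succ_mul_le M)
    ((s1.add s2).mul_left _)).trans ?_
  rw [tsum_mul_left]
  gcongr
  refine (Summable.tsum_add s1 s2).le.trans ?_
  rw [two_mul]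
  exact add_le_add (tsum_comp_le_tsum_of_inj h hpos i1) (tsum_comp_le_tsum_of_inj h hpos i2)

theorem exists_abs_le_of_tendsto {h : ℤ → ℝ} {G : ℝ} {q : ℕ}
    (hG : Tendsto (fun m : ℕ => h m) atTop (𝓝 G)) (hneg : ∀ m : ℕ, h (-m) = (-1) ^ q * h m) :
    ∃ C, ∀ m, |h m| ≤ C := by
  obtain ⟨C, hC⟩ := hG.norm.bddAbove_range
  refine ⟨C, fun m => ?_⟩
  rcases Int.eq_nat_or_neg m with ⟨k, rfl | rfl⟩
  · exact hC ⟨k, rfl⟩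
  · rw [hneg, abs_mul, abs_pow, abs_neg, abs_one, one_pow, one_mul]
    exact hC ⟨k, rfl⟩

theorem tendsto_shift_add {h : ℤ → ℝ} {G : ℝ} (hG : Tendsto (fun m : ℕ => h m) atTop (𝓝 G))
    (ε : ℝ) (k : ℕ) :
    Tendsto (fun M : ℕ => h (M - (k + 1)) + ε * h (M + (k + 1))) atTop (𝓝 ((1 + ε) * G)) := by
  rw [add_mul, one_mul]
  refine Tendsto.add ?_ (Tendsto.const_mul _ ?_)
  · rw [← tendsto_add_atTop_iff_nat (k + 1)]
    refine hG.congr fun M => ?_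
    push_cast
    rw [add_sub_cancel_right]
  · refine ((tendsto_add_atTop_iff_nat (k + 1)).2 hG).congr fun M => ?_
    push_cast
    rfl

theorem exists_tendsto_sum_of_two_le {q : ℕ} (hq : 2 ≤ q) {a : ℝ} (ha : a = 1 ∨ a = -1)
    {h : ℤ → ℝ} {G : ℝ} (hG : Tendsto (fun m : ℕ => h m) atTop (𝓝 G))
    (hneg : ∀ m : ℕ, h (-m) = (-1) ^ q * h m) :
    ∃ B : ℕ → ℝ, (∀ M : ℕ, Tendsto (fun K : ℕ => ∑ k ∈ Finset.range K,
      a ^ (k + 1) / ((k : ℝ) + 1) ^ q * (h (M - (k + 1)) + (-1) ^ q * h (M + (k + 1)))) atTop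
      (𝓝 (B M))) ∧ Tendsto B atTop (𝓝 ((1 + (-1) ^ q) * G * (a * lerchPhi a q 1))) := by
  obtain ⟨C, hC⟩ := exists_abs_le_of_tendsto hG hneg
  have ha1 : |a| = 1 := by rcases ha with h | h <;> simp [h]
  have hsum : Summable fun k : ℕ => 1 / ((k : ℝ) + 1) ^ q * (2 * C) := by
    have := (summable_nat_add_iff 1).2 (Real.summable_one_div_nat_pow.2 (by omega : 1 < q))
    simpa using this.mul_right (2 * C)
  have hbound (M k : ℕ) : ‖a ^ (k + 1) / ((k : ℝ) + 1) ^ q *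
      (h (M - (k + 1)) + (-1) ^ q * h (M + (k + 1)))‖ ≤ 1 / ((k : ℝ) + 1) ^ q * (2 * C) := by
    rw [norm_mul, norm_div, norm_pow, Real.norm_eq_abs, ha1, one_pow, norm_pow, Real.norm_eq_abs,
      abs_of_pos (by positivity : 0 < (k : ℝ) + 1)]
    gcongr
    refine (norm_add_le _ _).trans ?_
    rw [norm_mul, norm_pow, norm_neg, norm_one, one_pow, one_mul, two_mul]
    exact add_le_add (hC _) (hC _)
  have hlim : ∑' k : ℕ, a ^ (k + 1) / ((k : ℝ) + 1) ^ q * ((1 + (-1) ^ q) * G) =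
      (1 + (-1) ^ q) * G * (a * lerchPhi a q 1) := by
    rw [tsum_mul_right, mul_comm]
    congr 1
    have hs : Summable fun k : ℕ => a ^ (k + 1) / ((k : ℝ) + 1) ^ q := by
      refine Summable.of_norm_bounded ((summable_nat_add_iff 1).2
        (Real.summable_one_div_nat_pow.2 (by omega : 1 < q))) fun k => ?_
      rw [norm_div, norm_pow, Real.norm_eq_abs, ha1, one_pow, norm_pow, Real.norm_eq_abs,
        abs_of_pos (by positivity : 0 < (k : ℝ) + 1)]
      push_cast
      rfl
    refine tendsto_nhds_unique hs.hasSum.tendsto_sum_nat ?_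
    refine ((tendsto_lerchPhi ha (by omega : q ≠ 0) (by omega) one_pos).const_mul a).congr
      fun K => ?_
    rw [Finset.mul_sum]
    exact Finset.sum_congr rfl fun k _ => by ring
  refine ⟨fun M => ∑' k : ℕ, a ^ (k + 1) / ((k : ℝ) + 1) ^ q *
    (h (M - (k + 1)) + (-1) ^ q * h (M + (k + 1))), fun M => ?_, ?_⟩
  · exact (Summable.of_norm_bounded hsum (hbound M)).hasSum.tendsto_sum_nat
  · rw [← hlim]
    exact tendsto_tsum_of_dominated_convergence hsum
      (fun k => (tendsto_shift_add hG _ k).const_mul _) (Eventually.of_forall hbound)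

theorem sum_neg_one_pow_mul (w : ℕ → ℝ) (K : ℕ) :
    ∑ k ∈ Finset.range K, (-1) ^ k * w k =
      (∑ k ∈ Finset.range K, (-1) ^ k * (w k - w (k + 1)) + w 0 - (-1) ^ K * w K) / 2 := by
  induction K with
  | zero => simp
  | succ K ih =>
    rw [Finset.sum_range_succ, Finset.sum_range_succ, ih, pow_succ]
    ring

theorem exists_tendsto_sum_alternating {h : ℤ → ℝ} {G D : ℝ}
    (hG : Tendsto (fun m : ℕ => h m) atTop (𝓝 G)) (hneg : ∀ m : ℕ, h (-m) = (-1) ^ 1 * h m)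
    (hD : ∀ m : ℤ, |h m - h (m - 1)| ≤ D / (1 + |(m : ℝ)|)) :
    ∃ B : ℕ → ℝ, (∀ M : ℕ, Tendsto (fun K : ℕ => ∑ k ∈ Finset.range K,
      (-1) ^ k * ((h (M - (k + 1)) - h (M + (k + 1))) / ((k : ℝ) + 1))) atTop (𝓝 (B M))) ∧
      Tendsto B atTop (𝓝 0) := by
  obtain ⟨C, hC⟩ := exists_abs_le_of_tendsto hG hneg
  have hD0 : 0 ≤ D := by
    have := (abs_nonneg _).trans (hD 0)
    simpa using this
  set g : ℕ → ℕ → ℝ := fun M k => h (M - (k + 1)) - h (M + (k + 1)) with hg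
  have hgC (M k : ℕ) : |g M k| ≤ 2 * C := by
    rw [two_mul]
    exact (abs_sub _ _).trans (add_le_add (hC _) (hC _))
  have hg0 (k : ℕ) : Tendsto (fun M => g M k) atTop (𝓝 0) := by
    have := tendsto_shift_add hG (-1) k
    rw [add_neg_cancel, zero_mul] at this
    exact this.congr fun M => by rw [hg]; ring
  have hgD (M k : ℕ) : |g M k - g M (k + 1)| ≤ 2 * D * (1 / (1 + |(M : ℝ) - (k + 1)|)) := by
    have e : g M k - g M (k + 1) = (h (M - (k + 1)) - h (M - (k + 1) - 1)) +
        (h (M + (k + 2)) - h (M + (k + 2) - 1)) := by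
      simp only [hg]
      push_cast
      rw [show (M : ℤ) - (k + 1 + 1) = M - (k + 1) - 1 by ring,
        show (M : ℤ) + (k + 2) - 1 = M + (k + 1) by ring,
        show (M : ℤ) + (k + 1 + 1) = M + (k + 2) by ring]
      ring
    rw [e]
    refine (abs_add_le _ _).trans ((add_le_add (hD _) (hD _)).trans ?_)
    push_cast
    have h1 : |(M : ℝ) - (k + 1)| ≤ |(M : ℝ) + (k + 2)| := by
      rw [abs_of_nonneg (by positivity : 0 ≤ (M : ℝ) + (k + 2)), abs_le]
      constructor <;> linarith [(Nat.cast_nonneg M : (0 : ℝ) ≤ M), (Nat.cast_nonneg k : (0 : ℝ) ≤ k)]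
    have h2 : D / (1 + |(M : ℝ) + (k + 2)|) ≤ D / (1 + |(M : ℝ) - (k + 1)|) := by gcongr
    rw [mul_assoc, two_mul, mul_one_div]
    gcongr
  set T1 : ℕ → ℕ → ℝ := fun M k => (-1) ^ k * (g M k / (((k : ℝ) + 1) * (k + 2))) with hT1
  set T2 : ℕ → ℕ → ℝ := fun M k => (-1) ^ k * ((g M k - g M (k + 1)) / ((k : ℝ) + 2)) with hT2
  have hsq : Summable fun k : ℕ => 2 * C * (1 / ((k : ℝ) + 1) ^ 2) := by
    have := (summable_nat_add_iff 1).2 (Real.summable_one_div_nat_pow.2 (by norm_num : 1 < 2))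
    simpa using this.mul_left (2 * C)
  have hb1 (M k : ℕ) : ‖T1 M k‖ ≤ 2 * C * (1 / ((k : ℝ) + 1) ^ 2) := by
    have hC0 := (abs_nonneg _).trans (hgC M k)
    rw [hT1, norm_mul, norm_pow, norm_neg, norm_one, one_pow, one_mul, norm_div, mul_one_div,
      Real.norm_eq_abs, Real.norm_eq_abs, abs_of_pos (by positivity : 0 < ((k : ℝ) + 1) * (k + 2))]
    have := hgC M k
    gcongr
    nlinarith [(Nat.cast_nonneg k : (0 : ℝ) ≤ k)]
  have hb2 (M k : ℕ) :
      ‖T2 M k‖ ≤ 2 * D * (1 / (((k : ℝ) + 2) * (1 + |(M : ℝ) - (k + 1)|))) := by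
    rw [hT2, norm_mul, norm_pow, norm_neg, norm_one, one_pow, one_mul, norm_div,
      Real.norm_eq_abs, Real.norm_eq_abs, abs_of_pos (by positivity : 0 < (k : ℝ) + 2),
      show 2 * D * (1 / (((k : ℝ) + 2) * (1 + |(M : ℝ) - (k + 1)|))) =
        2 * D * (1 / (1 + |(M : ℝ) - (k + 1)|)) / (k + 2) by field_simp]
    exact div_le_div_of_nonneg_right (hgD M k) (by positivity)
  have s1 (M : ℕ) : Summable (T1 M) := Summable.of_norm_bounded hsq (hb1 M)
  have s2 (M : ℕ) : Summable (T2 M) :=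
    Summable.of_norm_bounded ((summable_one_div_succ_mul M).mul_left _) (hb2 M)
  have hT (M k : ℕ) : (-1) ^ k * (g M k / ((k : ℝ) + 1) - g M (k + 1) / (((k + 1 : ℕ) : ℝ) + 1)) =
      T1 M k + T2 M k := by
    simp only [hT1, hT2]
    push_cast
    rw [show (k : ℝ) + 1 + 1 = k + 2 by ring]
    field_simp
    ring
  refine ⟨fun M => (∑' k, (T1 M k + T2 M k) + g M 0) / 2, fun M => ?_, ?_⟩
  · have hw : Tendsto (fun K : ℕ => g M K / ((K : ℝ) + 1)) atTop (𝓝 0) := by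
      refine squeeze_zero_norm (fun K => ?_)
        ((tendsto_one_div_add_atTop_nhds_zero_nat (𝕜 := ℝ)).const_mul (2 * C) |>.trans
          (by rw [mul_zero]))
      rw [norm_div, Real.norm_eq_abs, Real.norm_eq_abs,
        abs_of_pos (by positivity : 0 < (K : ℝ) + 1), mul_one_div]
      have := hgC M K
      gcongr
    have h3 := ((((s1 M).add (s2 M)).hasSum.tendsto_sum_nat.add_const (g M 0)).sub
      (tendsto_sign_pow_mul (Or.inr rfl) hw)).div_const 2
    rw [sub_zero] at h3
    refine h3.congr fun K => ?_
    rw [sum_neg_one_pow_mul fun k => (h (M - (k + 1)) - h (M + (k + 1))) / ((k : ℝ) + 1)]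
    simp only [← hT]
    simp [hg]
  · have h1 : Tendsto (fun M => ∑' k, T1 M k) atTop (𝓝 (∑' _ : ℕ, (0 : ℝ))) := by
      refine tendsto_tsum_of_dominated_convergence hsq (fun k => ?_) (Eventually.of_forall hb1)
      have := ((hg0 k).div_const (((k : ℝ) + 1) * (k + 2))).const_mul ((-1) ^ k)
      simpa [hT1] using this
    have h2 : Tendsto (fun M => ∑' k, T2 M k) atTop (𝓝 0) := by
      have h4 := tendsto_tsum_one_div_succ_mul.const_mul (2 * D)
      rw [mul_zero] at h4
      refine squeeze_zero_norm (fun M => ?_) h4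
      rw [← tsum_mul_left]
      exact tsum_of_norm_bounded ((summable_one_div_succ_mul M).mul_left _).hasSum (hb2 M)
    rw [tsum_zero] at h1
    have h5 := ((h1.add h2).add (hg0 0)).div_const 2
    simp only [add_zero, zero_div] at h5
    refine h5.congr fun M => ?_
    rw [Summable.tsum_add (s1 M) (s2 M)]

theorem exists_tendsto_sum_shift {q : ℕ} (hq : q ≠ 0) {a : ℝ} (ha : a = 1 ∨ a = -1)
    (haq : ¬(a = 1 ∧ q = 1)) {h : ℤ → ℝ} {G D : ℝ}
    (hG : Tendsto (fun m : ℕ => h m) atTop (𝓝 G)) (hneg : ∀ m : ℕ, h (-m) = (-1) ^ q * h m)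
    (hD : ∀ m : ℤ, |h m - h (m - 1)| ≤ D / (1 + |(m : ℝ)|)) :
    ∃ B : ℕ → ℝ, (∀ M : ℕ, Tendsto (fun K : ℕ => ∑ k ∈ Finset.range K,
      a ^ (k + 1) / ((k : ℝ) + 1) ^ q * (h (M - (k + 1)) + (-1) ^ q * h (M + (k + 1)))) atTop
      (𝓝 (B M))) ∧ Tendsto B atTop (𝓝 ((1 + (-1) ^ q) * G * (a * lerchPhi a q 1))) := by
  by_cases h1 : q = 1
  · subst h1
    obtain rfl : a = -1 := by tauto
    obtain ⟨B, hB, hB0⟩ := exists_tendsto_sum_alternating hG hneg hD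
    refine ⟨fun M => -B M, fun M => (hB M).neg.congr fun K => ?_, ?_⟩
    · rw [← Finset.sum_neg_distrib]
      refine Finset.sum_congr rfl fun k _ => ?_
      rw [pow_succ]
      ring
    · simpa using hB0.neg
  · exact exists_tendsto_sum_of_two_le (by omega) ha hG hneg

theorem sum_range_mul_eq (f : ℕ → ℝ) (n M : ℕ) :
    ∑ i ∈ Finset.range (n * M), f i =
      ∑ u ∈ Finset.range M, ∑ v ∈ Finset.range n, f (n * u + v) := by
  induction M with
  | zero => simp
  | succ M ih => rw [Nat.mul_succ, Finset.sum_range_add, ih, Finset.sum_range_succ]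

theorem sum_one_add_neg_one_pow_mul (f : ℕ → ℝ) (q : ℕ) :
    ∑ j ∈ Finset.range (q + 1), (1 + (-1) ^ j) * f j =
      ∑ k ∈ Finset.range (q / 2 + 1), 2 * f (2 * k) := by
  have even (m : ℕ) : ∑ j ∈ Finset.range (2 * m + 1), (1 + (-1) ^ j) * f j =
      ∑ k ∈ Finset.range (m + 1), 2 * f (2 * k) := by
    induction m with
    | zero => norm_num
    | succ m ih =>
      rw [show 2 * (m + 1) + 1 = 2 * m + 1 + 1 + 1 by ring, Finset.sum_range_succ,
        Finset.sum_range_succ, ih, Finset.sum_range_succ (n := m + 1),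
        (odd_two_mul_add_one m).neg_one_pow, show 2 * m + 1 + 1 = 2 * (m + 1) by ring,
        (even_two_mul (m + 1)).neg_one_pow]
      norm_num
  rcases Nat.even_or_odd' q with ⟨m, rfl | rfl⟩
  · rw [even, Nat.mul_div_cancel_left _ two_pos]
  · rw [Finset.sum_range_succ, even, show (2 * m + 1) / 2 = m by omega, pow_succ, pow_mul]
    norm_num

theorem sum_range_choose_sub (p q : ℕ) :
    ∑ j ∈ Finset.range (p + 1), (q + p - j).choose q = (p + q + 1).choose p := by
  induction p with
  | zero => simp
  | succ p ih =>
    rw [Finset.sum_range_succ']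
    simp only [Nat.sub_zero, show ∀ j, q + (p + 1) - (j + 1) = q + p - j by omega, ih]
    rw [show p + 1 + q + 1 = (p + q + 1) + 1 by ring, Nat.choose_succ_succ,
      show q + (p + 1) = p + q + 1 by ring,
      Nat.choose_symm_of_eq_add (show p + q + 1 = q + p.succ by omega), add_comm]

theorem tendsto_sum_sign_pow_div {b : ℝ} (hb : b = 1 ∨ b = -1) {n r : ℕ} (hn : n ≠ 0)
    (hr : r ≠ 0) (hbr : ¬(b = 1 ∧ r = 1)) :
    Tendsto (fun M : ℕ => ∑ i ∈ Finset.range (n * M), b ^ i / ((2 * (i : ℝ) + 1) / (2 * n)) ^ r)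
      atTop (𝓝 ((n : ℝ) ^ r * lerchPhi b r (1 / 2))) := by
  have hn' : (n : ℝ) ≠ 0 := by exact_mod_cast hn
  have h1 : Tendsto (fun M : ℕ => n * M) atTop atTop :=
    tendsto_id.const_mul_atTop' (Nat.pos_of_ne_zero hn)
  refine (((tendsto_lerchPhi hb hr hbr one_half_pos).comp h1).const_mul ((n : ℝ) ^ r)).congr
    fun M => ?_
  rw [Function.comp, Finset.mul_sum]
  refine Finset.sum_congr rfl fun i _ => ?_
  rw [show (2 * (i : ℝ) + 1) / (2 * n) = (i + 1 / 2) / n by field_simp, div_pow, div_div_eq_mul_div]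
  ring

theorem tendsto_sum_sign_pow_div_mul {a b : ℝ} (ha : a = 1 ∨ a = -1) (hb : b = 1 ∨ b = -1)
    {n r : ℕ} (hr : r ≠ 0) (har : ¬(a = 1 ∧ r = 1)) (F : ℕ → ℝ) :
    Tendsto (fun M : ℕ => ∑ i ∈ Finset.range (n * M),
      b ^ i / ((2 * (i : ℝ) + 1) / (2 * n)) ^ r * ((a * b ^ n) ^ (i / n) * F (i % n))) atTop
      (𝓝 (∑ v ∈ Finset.range n, b ^ v * F v * lerchPhi a r ((2 * (v : ℝ) + 1) / (2 * n)))) := by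
  have h1 : Tendsto (fun M : ℕ => ∑ v ∈ Finset.range n, b ^ v * F v * ∑ u ∈ Finset.range M,
      a ^ u / ((u : ℝ) + (2 * (v : ℝ) + 1) / (2 * n)) ^ r) atTop
      (𝓝 (∑ v ∈ Finset.range n, b ^ v * F v * lerchPhi a r ((2 * (v : ℝ) + 1) / (2 * n)))) := by
    refine tendsto_finsetSum _ fun v hv => Tendsto.const_mul _ (tendsto_lerchPhi ha hr har ?_)
    have : 0 < (n : ℝ) := by exact_mod_cast (Nat.zero_le v).trans_lt (Finset.mem_range.1 hv)
    positivity
  refine h1.congr fun M => ?_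
  rw [sum_range_mul_eq]
  simp only [Finset.mul_sum]
  rw [Finset.sum_comm]
  refine Finset.sum_congr rfl fun u _ => Finset.sum_congr rfl fun v hv => ?_
  have hv := Finset.mem_range.1 hv
  have hn : 0 < n := (Nat.zero_le v).trans_lt hv
  have hn' : (n : ℝ) ≠ 0 := by exact_mod_cast hn.ne'
  rw [Nat.mul_add_div hn, Nat.div_eq_of_lt hv, add_zero, Nat.mul_add_mod, Nat.mod_eq_of_lt hv]
  push_cast
  rw [show (2 * ((n : ℝ) * u + v) + 1) / (2 * n) = u + (2 * v + 1) / (2 * n) by field_simp; ring]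
  have hbb : b ^ (n * u + v) * (a * b ^ n) ^ u = b ^ v * a ^ u := by
    rw [mul_pow, ← pow_mul, pow_add, show b ^ (n * u) * b ^ v * (a ^ u * b ^ (n * u)) =
      (b * b) ^ (n * u) * (b ^ v * a ^ u) by rw [mul_pow]; ring]
    rcases hb with h | h <;> simp [h]
  rw [div_mul_eq_mul_div, ← mul_assoc, hbb]
  ring

/-- The value of `∑_{k ≠ 0} c ^ k / (k ^ (q + 1) * (α - k) ^ (p + 1))` at `α = (2 i + 1) / (2 n)`,
where `c = a * b ^ n`. -/
theorem tendsto_sum_pairTerm_odd {c : ℝ} (hc : c = 1 ∨ c = -1) (p q : ℕ) {n : ℕ} (hn : n ≠ 0)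
    (i : ℕ) :
    Tendsto (fun K : ℕ => ∑ k ∈ Finset.range K,
        pairTerm c (p + 1) (q + 1) ((2 * (i : ℝ) + 1) / (2 * n)) k) atTop
      (𝓝 (∑ j ∈ Finset.range (q + 1), ((p + q - j).choose p : ℝ) /
            ((2 * (i : ℝ) + 1) / (2 * n)) ^ (p + q + 1 - j) *
            ((1 + (-1) ^ (j + 1)) * (c * lerchPhi c (j + 1) 1)) +
          ∑ j ∈ Finset.range (p + 1), ((q + p - j).choose q : ℝ) /
            ((2 * (i : ℝ) + 1) / (2 * n)) ^ (q + p + 1 - j) *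
            (c ^ (i / n) * lerchTheta c (j + 1) (2 * ((i % n : ℕ) : ℝ) + 1) (2 * n) -
              1 / ((2 * (i : ℝ) + 1) / (2 * n)) ^ (j + 1)))) := by
  have hn0 : 0 < n := Nat.pos_of_ne_zero hn
  have hn' : (n : ℝ) ≠ 0 := by exact_mod_cast hn
  refine tendsto_sum_pairTerm hc p q _ (by positivity) (fun k h => ?_) (fun k => by positivity)
    fun j => ?_
  · field_simp at h
    have h2 : (2 * i + 1 : ℤ) - 2 * n * (k + 1) = 0 := by exact_mod_cast h
    have h3 : (2 * i + 1 : ℤ) = 2 * (n * (k + 1)) := by linarith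
    omega
  · have hmod : i % n + 1 ≤ n := Nat.mod_lt i hn0
    have hmod' : ((i % n : ℕ) : ℝ) + 1 ≤ n := by exact_mod_cast hmod
    have h := (hasBilateralSum_lerchTheta hc (j.succ_ne_zero : j + 1 ≠ 0)
      (s := 2 * ((i % n : ℕ) : ℝ) + 1) (r := 2 * n) (by positivity) (by linarith)).add_nat hc
      j.succ_ne_zero (i / n)
    convert h using 1
    have hi : (n : ℝ) * ((i / n : ℕ) : ℝ) + ((i % n : ℕ) : ℝ) = i := by
      exact_mod_cast Nat.div_add_mod i n
    rw [← hi]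
    field_simp
    ring

theorem tendsto_sum_sum_pairTerm {a b : ℝ} (ha : a = 1 ∨ a = -1) (hb : b = 1 ∨ b = -1) (p q : ℕ)
    {n : ℕ} (hn : n ≠ 0) (hpb : ¬(b = 1 ∧ p = 0)) (hqa : ¬(a = 1 ∧ q = 0)) :
    ∃ A : ℕ → ℝ, (∀ M : ℕ, Tendsto (fun K : ℕ => ∑ k ∈ Finset.range K,
        ∑ i ∈ Finset.range (n * M),
          b ^ i * pairTerm (a * b ^ n) (p + 1) (q + 1) ((2 * (i : ℝ) + 1) / (2 * n)) k) atTop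
        (𝓝 (A M))) ∧
      Tendsto A atTop (𝓝
        (∑ j ∈ Finset.range (q + 1), ((p + q - j).choose p : ℝ) *
            ((1 + (-1) ^ (j + 1)) * (a * b ^ n * lerchPhi (a * b ^ n) (j + 1) 1)) *
            ((n : ℝ) ^ (p + q + 1 - j) * lerchPhi b (p + q + 1 - j) (1 / 2)) +
          ∑ j ∈ Finset.range (p + 1), ((q + p - j).choose q : ℝ) *
            (∑ v ∈ Finset.range n,
              b ^ v * lerchTheta (a * b ^ n) (j + 1) (2 * (v : ℝ) + 1) (2 * n) *
              lerchPhi a (q + p + 1 - j) ((2 * (v : ℝ) + 1) / (2 * n)) -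
              (n : ℝ) ^ (p + q + 2) * lerchPhi b (p + q + 2) (1 / 2)))) := by
  have hc : a * b ^ n = 1 ∨ a * b ^ n = -1 := by
    rcases ha with rfl | rfl <;> rcases hb with rfl | rfl <;>
      rcases neg_one_pow_eq_or ℝ n with h | h <;> simp [h]
  set c := a * b ^ n with hcdef
  have h1 := (tendsto_finsetSum (Finset.range (q + 1)) fun j hj =>
    (tendsto_sum_sign_pow_div hb hn (r := p + q + 1 - j)
      (by have := Finset.mem_range.1 hj; omega)
      (fun h => hpb ⟨h.1, by have := Finset.mem_range.1 hj; omega⟩)).const_mul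
      (((p + q - j).choose p : ℝ) * ((1 + (-1) ^ (j + 1)) * (c * lerchPhi c (j + 1) 1)))).add
    (tendsto_finsetSum (Finset.range (p + 1)) fun j hj =>
      ((tendsto_sum_sign_pow_div_mul ha hb (n := n) (r := q + p + 1 - j)
        (by have := Finset.mem_range.1 hj; omega)
        (fun h => hqa ⟨h.1, by have := Finset.mem_range.1 hj; omega⟩)
        fun v => lerchTheta c (j + 1) (2 * (v : ℝ) + 1) (2 * n)).sub
        (tendsto_sum_sign_pow_div hb hn (r := p + q + 2) (by omega) (by omega))).const_mul
      ((q + p - j).choose q : ℝ))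
  refine ⟨_, fun M => ?_, h1⟩
  have h2 := tendsto_finsetSum (Finset.range (n * M)) fun i _ =>
    (tendsto_sum_pairTerm_odd hc p q hn i).const_mul (b ^ i)
  refine (h2.congr fun K => ?_).trans (le_of_eq ?_)
  · rw [Finset.sum_comm]
    simp only [Finset.mul_sum]
  · congr 1
    simp only [mul_add, Finset.mul_sum, Finset.sum_add_distrib, ← Finset.sum_sub_distrib]
    rw [Finset.sum_comm, Finset.sum_comm (t := Finset.range (p + 1))]
    congr 1
    · refine Finset.sum_congr rfl fun j _ => Finset.sum_congr rfl fun i _ => ?_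
      ring
    · refine Finset.sum_congr rfl fun j hj => Finset.sum_congr rfl fun i _ => ?_
      have hj := Finset.mem_range.1 hj
      rw [← hcdef, show p + q + 2 = (q + p + 1 - j) + (j + 1) by omega, pow_add _ _ (j + 1)]
      simp only [div_eq_mul_inv, mul_inv]
      ring

theorem even_part_eq (p q n : ℕ) {c : ℝ} (hc : c = 1 ∨ c = -1) (b : ℝ) :
    ∑ j ∈ Finset.range (q + 1), ((p + q - j).choose p : ℝ) *
        ((1 + (-1) ^ (j + 1)) * (c * lerchPhi c (j + 1) 1)) *
        ((n : ℝ) ^ (p + q + 1 - j) * lerchPhi b (p + q + 1 - j) (1 / 2)) -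
      ∑ j ∈ Finset.range (p + 1), ((q + p - j).choose q : ℝ) *
        ((n : ℝ) ^ (p + q + 2) * lerchPhi b (p + q + 2) (1 / 2)) =
    ∑ k ∈ Finset.range ((q + 1) / 2 + 1), 2 * (((p + q + 1 - 2 * k).choose p : ℝ) *
      (c * lerchPhi c (2 * k) 1) *
      ((n : ℝ) ^ (p + q + 2 - 2 * k) * lerchPhi b (p + q + 2 - 2 * k) (1 / 2))) := by
  have h0 : 2 * (c * lerchPhi c 0 1) = -1 := by
    rcases hc with rfl | rfl <;> norm_num [lerchPhi]
  rw [← sum_one_add_neg_one_pow_mul (fun j => ((p + q + 1 - j).choose p : ℝ) *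
      (c * lerchPhi c j 1) *
      ((n : ℝ) ^ (p + q + 2 - j) * lerchPhi b (p + q + 2 - j) (1 / 2))), Finset.sum_range_succ' (n := q + 1),
    sub_eq_add_neg, ← Finset.sum_mul, ← Nat.cast_sum, sum_range_choose_sub]
  congr 1
  · refine Finset.sum_congr rfl fun j _ => ?_
    rw [show p + q + 1 - (j + 1) = p + q - j by omega,
      show p + q + 2 - (j + 1) = p + q + 1 - j by omega]
    ring
  · simp only [Nat.sub_zero]
    linear_combination (-((p + q + 1).choose p : ℝ) *
      ((n : ℝ) ^ (p + q + 2) * lerchPhi b (p + q + 2) (1 / 2))) * h0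

theorem sum_lerchTheta_reflect {c : ℝ} (hc : c = 1 ∨ c = -1) (b : ℝ) {p n : ℕ} (hn : n ≠ 0)
    (hb : b = 1 ∨ b = -1) (C : ℕ → ℝ) (φ : ℕ → ℝ → ℝ) :
    ∑ j ∈ Finset.Icc 1 n, ∑ k ∈ Finset.Icc 1 p, C k * b ^ j * (-1) ^ k *
        lerchTheta c k (2 * (j : ℝ) - 1) (2 * (n : ℝ)) *
        φ k ((2 * (n : ℝ) - 2 * (j : ℝ) + 1) / (2 * (n : ℝ))) =
      c * b ^ n * ∑ j ∈ Finset.range p, C (j + 1) * ∑ v ∈ Finset.range n,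
        b ^ v * lerchTheta c (j + 1) (2 * (v : ℝ) + 1) (2 * n) *
          φ (j + 1) ((2 * (v : ℝ) + 1) / (2 * n)) := by
  have hn' : (n : ℝ) ≠ 0 := by exact_mod_cast hn
  rw [sum_Icc_one_eq_sum_range (fun _ => _) n, ← Finset.sum_range_reflect]
  simp only [Finset.mul_sum]
  rw [Finset.sum_comm (s := Finset.range p)]
  refine Finset.sum_congr rfl fun v hv => ?_
  rw [sum_Icc_one_eq_sum_range (fun _ => _) p]
  refine Finset.sum_congr rfl fun k _ => ?_
  have hv := Finset.mem_range.1 hv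
  have hcast : ((n - 1 - v + 1 : ℕ) : ℝ) = n - v := by
    rw [show n - 1 - v + 1 = n - v by omega, Nat.cast_sub hv.le]
  have hpow : b ^ (n - 1 - v + 1) = b ^ n * b ^ v := by
    rw [show b ^ n = b ^ (n - 1 - v + 1) * b ^ v by rw [← pow_add]; congr 1; omega, mul_assoc,
      ← mul_pow]
    rcases hb with h | h <;> simp [h]
  have hsign : ((-1 : ℝ) ^ (k + 1)) * (-1) ^ (k + 1) = 1 := by rw [← mul_pow]; norm_num
  rw [hcast, hpow, show 2 * ((n : ℝ) - v) - 1 = 2 * n - (2 * v + 1) by ring,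
    lerchTheta_sub hc _ (mul_ne_zero two_ne_zero hn'),
    show 2 * (n : ℝ) - 2 * (n - v) + 1 = 2 * v + 1 by ring]
  linear_combination (C (k + 1) * b ^ n * b ^ v * c * lerchTheta c (k + 1) (2 * (v : ℝ) + 1) (2 * n) *
    φ (k + 1) ((2 * (v : ℝ) + 1) / (2 * n))) * hsign

theorem theorem6 (p q n : ℕ) (hp : 0 < p) (hq : 0 < q) (hn : 0 < n)
    (a b : ℝ) (ha : a = 1 ∨ a = -1) (hb : b = (-1) ^ (p + q - 1))
    (hpb : b = 1 → p ≠ 1) (hqa : a = 1 → q ≠ 1) :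
    Tendsto
      (fun N : ℕ => ∑ k ∈ Finset.Icc 1 N, a ^ k * oddHarmonic p b (n * k) / (k : ℝ) ^ q)
      atTop
      (𝓝
        (a / 2 * (1 + (-1) ^ q) * (2 : ℝ) ^ (-(p : ℤ)) * lerchPhi a q 1 * lerchPhi b p (1 / 2)
          + a * b ^ (n - 1) * (n : ℝ) ^ q * (-2 : ℝ) ^ (-(p : ℤ)) *
              ∑ k ∈ Finset.range (q / 2 + 1),
                ((p + q - 2 * k - 1).choose (p - 1) : ℝ) * (n : ℝ) ^ (-(2 * (k : ℤ))) *
                  lerchPhi (a * b ^ n) (2 * k) 1 * lerchPhi b (p + q - 2 * k) (1 / 2)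
          + a * b / 2 * (-(2 * (n : ℝ))) ^ (-(p : ℤ)) *
              ∑ j ∈ Finset.Icc 1 n, ∑ k ∈ Finset.Icc 1 p,
                ((p + q - k - 1).choose (q - 1) : ℝ) * b ^ j * (-1) ^ k *
                  lerchTheta (a * b ^ n) k (2 * (j : ℝ) - 1) (2 * (n : ℝ)) *
                  lerchPhi a (p + q - k)
                    ((2 * (n : ℝ) - 2 * (j : ℝ) + 1) / (2 * (n : ℝ))))) := by
  obtain ⟨p, rfl⟩ := Nat.exists_eq_add_of_lt hp
  obtain ⟨q, rfl⟩ := Nat.exists_eq_add_of_lt hq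
  simp only [zero_add] at *
  have hn0 : n ≠ 0 := hn.ne'
  have hn' : (n : ℝ) ≠ 0 := by exact_mod_cast hn0
  have hb1 : b = 1 ∨ b = -1 := by rw [hb]; exact neg_one_pow_eq_or ℝ _
  have hc : a * b ^ n = 1 ∨ a * b ^ n = -1 := by
    rcases ha with rfl | rfl <;> rcases hb1 with h | h <;> rw [h] <;>
      rcases neg_one_pow_eq_or ℝ n with h | h <;> simp [h]
  have hε : b * (-1) ^ (p + 1) = -(-1) ^ (q + 1) := by
    rw [hb, show p + 1 + (q + 1) - 1 = p + q + 1 by omega, ← pow_add,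
      show p + q + 1 + (p + 1) = q + 2 * (p + 1) by ring, pow_add, pow_mul]
    norm_num [pow_succ]
  obtain ⟨A, hA, hAlim⟩ := tendsto_sum_sum_pairTerm ha hb1 p q hn0
    (fun h => hpb h.1 (by rw [h.2])) (fun h => hqa h.1 (by rw [h.2]))
  set ε : ℝ := (-1) ^ (q + 1) with hεdef
  have hε2 : ε * ε = 1 := by rcases neg_one_pow_eq_or ℝ (q + 1) with h | h <;> rw [hεdef, h] <;> simp
  set h : ℤ → ℝ := fun m => oddHarmonicInt (p + 1) b ε (n * m) with hh
  have hmul : Tendsto (fun M : ℕ => n * M) atTop atTop := tendsto_id.const_mul_atTop' hn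
  have hG : Tendsto (fun m : ℕ => h m) atTop
      (𝓝 ((2 ^ (p + 1))⁻¹ * lerchPhi b (p + 1) (1 / 2))) := by
    refine ((tendsto_oddHarmonic hb1 p.succ_ne_zero fun h => hpb h.1 h.2).comp hmul).congr
      fun m => ?_
    simp only [hh, Function.comp]
    rw [← Nat.cast_mul, oddHarmonicInt_natCast]
  have hneg (m : ℕ) : h (-m) = (-1) ^ (q + 1) * h m := by
    simp only [hh]
    rw [mul_neg, ← Nat.cast_mul, oddHarmonicInt_neg_natCast, oddHarmonicInt_natCast]
  obtain ⟨B, hB, hBlim⟩ := exists_tendsto_sum_shift (q := q + 1) q.succ_ne_zero ha (fun h => hqa h.1 h.2) hG hneg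
    (abs_oddHarmonicInt_sub_le p.succ_ne_zero hb1 hε)
  set S : ℕ → ℝ := fun N => ∑ k ∈ Finset.Icc 1 N,
    a ^ k * oddHarmonic (p + 1) b (n * k) / (k : ℝ) ^ (q + 1) with hS
  have hSlim (M : ℕ) : Tendsto S atTop (𝓝 (ε / 2 * (B M - A M / (2 * n) ^ (p + 1)))) := by
    refine (((hB M).sub ((hA M).div_const _)).const_mul (ε / 2)).congr fun K => ?_
    simp only [sum_pairTerm hn0 hb1 hε, hS]
    rw [sum_Icc_one_eq_sum_range (fun k => a ^ k * oddHarmonic (p + 1) b (n * k) / (k : ℝ) ^ (q + 1)),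
      ← Finset.mul_sum, mul_div_cancel_left₀ _ (by positivity), ← Finset.sum_sub_distrib,
      Finset.mul_sum]
    refine Finset.sum_congr rfl fun k _ => ?_
    simp only [hh]
    push_cast
    rw [mul_sub (n : ℤ) M, mul_add (n : ℤ) M, ← hεdef]
    linear_combination (a ^ (k + 1) * oddHarmonic (p + 1) b (n * (k + 1)) / ((k : ℝ) + 1) ^ (q + 1)) * hε2
  have hconst : Tendsto (fun M => ε / 2 * (B M - A M / (2 * n) ^ (p + 1))) atTop
      (𝓝 (ε / 2 * (B 0 - A 0 / (2 * n) ^ (p + 1)))) :=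
    tendsto_const_nhds.congr fun M => tendsto_nhds_unique (hSlim 0) (hSlim M)
  have hval := tendsto_nhds_unique hconst ((hBlim.sub (hAlim.div_const _)).const_mul (ε / 2))
  refine (hSlim 0).trans (le_of_eq (congrArg 𝓝 (hval.trans ?_)))
  simp only [mul_sub ((_ : ℕ) : ℝ) (∑ v ∈ Finset.range n, _), Finset.sum_sub_distrib]
  rw [add_sub_left_comm, even_part_eq p q n hc b]
  rw [sum_lerchTheta_reflect hc b hn0 hb1
    (fun k => ((p + 1 + (q + 1) - k - 1).choose (q + 1 - 1) : ℝ))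
    (fun k => lerchPhi a (p + 1 + (q + 1) - k))]
  have hE : ∑ k ∈ Finset.range ((q + 1) / 2 + 1), 2 * (((p + q + 1 - 2 * k).choose p : ℝ) *
      (a * b ^ n * lerchPhi (a * b ^ n) (2 * k) 1) *
      ((n : ℝ) ^ (p + q + 2 - 2 * k) * lerchPhi b (p + q + 2 - 2 * k) (1 / 2))) =
      2 * (a * b ^ n) * (n : ℝ) ^ (p + q + 2) * ∑ k ∈ Finset.range ((q + 1) / 2 + 1),
        ((p + 1 + (q + 1) - 2 * k - 1).choose (p + 1 - 1) : ℝ) * (n : ℝ) ^ (-(2 * (k : ℤ))) *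
          lerchPhi (a * b ^ n) (2 * k) 1 * lerchPhi b (p + 1 + (q + 1) - 2 * k) (1 / 2) := by
    rw [Finset.mul_sum]
    refine Finset.sum_congr rfl fun k hk => ?_
    have hk := Finset.mem_range.1 hk
    have hpow : (n : ℝ) ^ (p + q + 2 - 2 * k) =
        (n : ℝ) ^ (p + q + 2) * (n : ℝ) ^ (-(2 * (k : ℤ))) := by
      rw [← zpow_natCast, ← zpow_natCast, ← zpow_add₀ hn', Nat.cast_sub (by omega)]
      push_cast
      ring_nf
    rw [hpow, show p + 1 + (q + 1) - 2 * k - 1 = p + q + 1 - 2 * k by omega,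
      show p + 1 + (q + 1) - 2 * k = p + q + 2 - 2 * k by omega, Nat.add_sub_cancel]
    ring
  have hT (j : ℕ) : q + p + 1 - j - 1 = q + p - j ∧
      p + 1 + (q + 1) - (j + 1) = q + p + 1 - j := by omega
  simp only [hE, (hT _).1, (hT _).2, Nat.add_sub_cancel q 1]
  have combine (E T X Y : ℝ) : ε / 2 * ((1 + ε) * ((2 ^ (p + 1))⁻¹ * Y) * (a * X) -
      (T + 2 * (a * b ^ n) * (n : ℝ) ^ (p + q + 2) * E) / (2 * n) ^ (p + 1)) =
      a / 2 * (1 + ε) * (2 : ℝ) ^ (-((p + 1 : ℕ) : ℤ)) * X * Y +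
        a * b ^ (n - 1) * (n : ℝ) ^ (q + 1) * (-2) ^ (-((p + 1 : ℕ) : ℤ)) * E +
        a * b / 2 * (-(2 * (n : ℝ))) ^ (-((p + 1 : ℕ) : ℤ)) * (a * b ^ n * b ^ n * T) := by
    rw [zpow_neg, zpow_neg, zpow_neg, zpow_natCast, zpow_natCast, zpow_natCast,
      neg_pow 2 (p + 1), neg_pow (2 * (n : ℝ)) (p + 1), mul_inv, mul_inv,
      show p + q + 2 = (p + 1) + (q + 1) by ring, pow_add (n : ℝ), mul_pow 2 (n : ℝ)]
    have hbn : b ^ n = b ^ (n - 1) * b := by rw [← pow_succ, Nat.sub_add_cancel hn]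
    have hε' : ε = -(b * (-1) ^ (p + 1)) := by rw [hε, neg_neg]
    have hnP : (n : ℝ) ^ (p + 1) ≠ 0 := pow_ne_zero _ hn'
    rw [hbn]
    rcases ha with rfl | rfl <;> rcases hb1 with hb' | hb' <;>
      rcases neg_one_pow_eq_or ℝ (p + 1) with hs | hs <;>
      rcases neg_one_pow_eq_or ℝ (n - 1) with hm | hm <;>
      simp only [hε', hs, hb', hm, one_pow] <;> field_simp <;> ring
  exact combine _ _ _ _
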